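/- For a complex square matrix $T$ let $\Re(T)=\frac{T+T^*}{2}$ and $|T|=(T^*T)^{1/2}$; $T$ is accretive if $\Re(T)\ge O$ and strictly accretive if $\Re(T)>O$, where $\le$ is the Loewner order. For $A,B\in\mathcal M_n(\mathbb C)$ strictly accretive and $0\le t\le 1$, let $$A\sharp_t B=A^{1/2}\left(A^{-1/2}BA^{-1/2}\right)^tA^{1/2},$$ where the powers are the matrix functions (holomorphic functional calculus) of the principal branches of $z\mapsto z^{r}$ on $\mathbb C\setminus(-\infty,0]$. Let $A,B,X,Y\in\mathcal M_n(\mathbb C)$ with $A,B$ strictly accretive, and suppose that $M=\begin{bmatrix}A&X\\Y^*&B\end{bmatrix}$ is accretive partial transpose (APT), that is, both $M$ and its partial transpose $M^\tau=\begin{bmatrix}A&Y^*\\X&B\end{bmatrix}$ are accretive. Let $V$ be a unitary matrix in a polar decomposition of $\frac{X+Y}{2}$, that is, $V$ is unitary and $\frac{X+Y}{2}=V\left|\frac{X+Y}{2}\right|$. Then for every $t\in[0,1]$, $$\left|\frac{X+Y}{2}\right|\le\frac12\,\Re\left(A\sharp_tB+V^*(A\sharp_{1-t}B)V\right)$$ and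 $$\left|\frac{X^*+Y^*}{2}\right|\le\frac12\,\Re\left(V(A\sharp_tB)V^*+A\sharp_{1-t}B\right).$$ -/

import Mathlib

open scoped MatrixOrder ComplexStarModule ComplexOrder Matrix Polynomial

/-- Hermite interpolation: for a polynomial `q` over `ℂ` and any function `f` there is a
polynomial `p` whose derivatives of order `k` agree with those of `f` at each root `z` of `q`,
for all `k` smaller than the multiplicity of `z`. -/
theorem exists_hermite_interpolant (q : ℂ[X]) (f : ℂ → ℂ) :
    ∃ p : ℂ[X], ∀ (z : ℂ) (k : ℕ), k < q.rootMultiplicity z →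
      ((Polynomial.derivative^[k]) p).eval z = iteratedDeriv k f z := by
  classical
  obtain ⟨p, hp⟩ := Ideal.exists_forall_sub_mem_ideal
    (I := fun z : q.roots.toFinset =>
      Ideal.span {(Polynomial.X - Polynomial.C (z : ℂ)) ^ q.rootMultiplicity (z : ℂ)})
    (fun z w hzw => (Ideal.isCoprime_span_singleton_iff _ _).2
      (Polynomial.isCoprime_X_sub_C_of_isUnit_sub
        (sub_ne_zero.2 (Subtype.coe_injective.ne hzw)).isUnit).pow)
    (fun z => ∑ j ∈ Finset.range (q.rootMultiplicity (z : ℂ)),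
      Polynomial.C (iteratedDeriv j f z / (j.factorial : ℂ)) *
        (Polynomial.X - Polynomial.C (z : ℂ)) ^ j)
  refine ⟨p, fun z k hk => ?_⟩
  have hz : z ∈ q.roots.toFinset := by
    rw [Multiset.mem_toFinset, ← Multiset.count_pos, Polynomial.count_roots]
    omega
  obtain ⟨r, hr⟩ := Ideal.mem_span_singleton.1 (hp ⟨z, hz⟩)
  rw [sub_eq_iff_eq_add] at hr
  have key : (Polynomial.taylor z p).coeff k = iteratedDeriv k f z / (k.factorial : ℂ) := by
    rw [hr]
    simp only [map_add, map_sum, Polynomial.taylor_mul, Polynomial.taylor_pow, map_sub,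
      Polynomial.taylor_X, Polynomial.taylor_C, add_sub_cancel_right, Polynomial.coeff_add,
      Polynomial.finsetSum_coeff, Polynomial.coeff_C_mul, Polynomial.coeff_X_pow,
      Polynomial.coeff_X_pow_mul', if_neg (not_le.2 hk), zero_add]
    simp [hk]
  have hfac : (k.factorial : ℂ) ≠ 0 := Nat.cast_ne_zero.2 k.factorial_ne_zero
  rw [Polynomial.taylor_coeff, eq_div_iff hfac] at key
  rw [← key, ← Polynomial.factorial_smul_hasseDeriv]
  simp [mul_comm]

noncomputable section

/-- The matrix function `f(A)` (holomorphic functional calculus in finite dimension):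
`f(A) = p(A)` for any polynomial `p` that agrees with `f`, together with its derivatives up to
order `m - 1`, at every root of the minimal polynomial of `A` of multiplicity `m`. It is meant
for `f` holomorphic near the spectrum of `A`. -/
def matrixFunction {n : ℕ} (f : ℂ → ℂ) (A : Matrix (Fin n) (Fin n) ℂ) :
    Matrix (Fin n) (Fin n) ℂ :=
  Polynomial.aeval A (Classical.choose (exists_hermite_interpolant (minpoly ℂ A) f))

/-- The value `p(A)` does not depend on the chosen interpolating polynomial. -/
theorem matrixFunction_eq_aeval {n : ℕ} (f : ℂ → ℂ) (A : Matrix (Fin n) (Fin n) ℂ) (p : ℂ[X])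
    (hp : ∀ (z : ℂ) (k : ℕ), k < (minpoly ℂ A).rootMultiplicity z →
      ((Polynomial.derivative^[k]) p).eval z = iteratedDeriv k f z) :
    matrixFunction f A = Polynomial.aeval A p := by
  have hq : minpoly ℂ A ≠ 0 := minpoly.ne_zero (Algebra.IsIntegral.isIntegral A)
  have hc := Classical.choose_spec (exists_hermite_interpolant (minpoly ℂ A) f)
  rw [matrixFunction]
  generalize Classical.choose (exists_hermite_interpolant (minpoly ℂ A) f) = c at hc ⊢
  rw [← sub_eq_zero, ← map_sub, ← minpoly.dvd_iff]
  rcases eq_or_ne (c - p) 0 with h0 | h0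
  · rw [h0]
    exact dvd_zero _
  refine (IsAlgClosed.dvd_iff_roots_le_roots hq h0).2 (Multiset.le_iff_count.2 fun z => ?_)
  rw [Polynomial.count_roots, Polynomial.count_roots]
  by_contra! hlt
  refine lt_irrefl _ (Polynomial.lt_rootMultiplicity_of_isRoot_iterate_derivative_of_mem_nonZeroDivisors
    h0 (t := z) (n := (c - p).rootMultiplicity z) (fun k hk => ?_) ?_)
  · rw [Polynomial.IsRoot, Polynomial.iterate_derivative_sub, Polynomial.eval_sub,
      hc z k (hk.trans_lt hlt), hp z k (hk.trans_lt hlt), sub_self]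
  · exact mem_nonZeroDivisors_of_ne_zero (Nat.cast_ne_zero.2 (Nat.factorial_ne_zero _))

/-- The principal power `A ^ r` of a matrix with no eigenvalue in `(-∞, 0]`: the matrix function
of the principal branch of `z ↦ z ^ r`. -/
def matrixPower {n : ℕ} (A : Matrix (Fin n) (Fin n) ℂ) (r : ℝ) : Matrix (Fin n) (Fin n) ℂ :=
  matrixFunction (fun z : ℂ => z ^ (r : ℂ)) A

/-- The weighted geometric mean
`A ♯ₜ B = A^{1/2} (A^{-1/2} B A^{-1/2})^t A^{1/2}` of strictly accretive matrices. -/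
def geomMean {n : ℕ} (t : ℝ) (A B : Matrix (Fin n) (Fin n) ℂ) : Matrix (Fin n) (Fin n) ℂ :=
  matrixPower A (1 / 2) *
    matrixPower (matrixPower A (-(1 / 2)) * B * matrixPower A (-(1 / 2))) t *
    matrixPower A (1 / 2)

/-- `A` is accretive: its real part `(A + A*) / 2` is positive semidefinite. -/
def IsAccretive {m : Type*} [Fintype m] (A : Matrix m m ℂ) : Prop :=
  (ℜ A : Matrix m m ℂ).PosSemidef

/-- `A` is strictly accretive: its real part `(A + A*) / 2` is positive definite. -/
def IsStrictlyAccretive {m : Type*} [Fintype m] (A : Matrix m m ℂ) : Prop :=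
  (ℜ A : Matrix m m ℂ).PosDef

/-- The partial transpose of a `2 × 2` block matrix: the off-diagonal blocks are exchanged. -/
def partialTranspose {n : ℕ} (M : Matrix (Fin n ⊕ Fin n) (Fin n ⊕ Fin n) ℂ) :
    Matrix (Fin n ⊕ Fin n) (Fin n ⊕ Fin n) ℂ :=
  Matrix.fromBlocks M.toBlocks₁₁ M.toBlocks₂₁ M.toBlocks₁₂ M.toBlocks₂₂

/-- `M` is accretive partial transpose (APT): `M` and its partial transpose are accretive. -/
def IsAPT {n : ℕ} (M : Matrix (Fin n ⊕ Fin n) (Fin n ⊕ Fin n) ℂ) : Prop :=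
  IsAccretive M ∧ IsAccretive (partialTranspose M)

end

/-! Write `Z = (X + Y) / 2`. Testing the two accretive block matrices on `(u, -v)` shows that `2
Re⟨u, Z* v⟩` is at most both `Re⟨u, Au⟩ + Re⟨v, Bv⟩` and `Re⟨u, Bu⟩ + Re⟨v, Av⟩`. These are the
cases `t = 0, 1` of `2 Re⟨x, Z* y⟩ ≤ Re⟨x, (A ♯ₜ B) x⟩ + Re⟨y, (A ♯₁₋ₜ B) y⟩`, proved for all `t` in
`two_re_dotProduct_mulVec_le_re_geomMean`. The theorem follows by taking `y = Vx`, respectively `V*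
x` and `x`, in this inequality.

For `0 < t < 1`, the formula `z ^ p = c ∫ s^(p-1) z / (z + s) ds` turns the form of a mean into an
integral of `Re⟨u, Au⟩ + s Re⟨g, Bg⟩` over splittings `x = u + s g` (`re_geomMean_eq_integral`). A
congruence takes `Re B` to `1` and `Re A` to `diag d`. In these coordinates, minimizing over
splittings bounds the `y` term below by `∑ |yᵢ|² dᵢ^t`, while the two endpoint inequalities bound
the `x` term below by `∑ |zᵢ|² dᵢ^(-t)`, where `zᵢ` are the coefficients of the pairing. The
arithmetic-geometric mean inequality in each coordinate concludes. -/

/-! ### Algebra of matrix functions. -/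

open Topology Filter in
theorem matrixFunction_congr {n : ℕ} {f g : ℂ → ℂ} {A : Matrix (Fin n) (Fin n) ℂ}
    (h : ∀ z, (minpoly ℂ A).IsRoot z → f =ᶠ[𝓝 z] g) :
    matrixFunction f A = matrixFunction g A := by
  obtain ⟨p, hp⟩ := exists_hermite_interpolant (minpoly ℂ A) g
  rw [matrixFunction_eq_aeval g A p hp]
  refine matrixFunction_eq_aeval f A p fun z k hk => ?_
  have hq : minpoly ℂ A ≠ 0 := minpoly.ne_zero (Algebra.IsIntegral.isIntegral A)
  rw [hp z k hk, (h z ((Polynomial.rootMultiplicity_pos hq).1 (by omega))).iteratedDeriv_eq]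

theorem Polynomial.iteratedDeriv_eval (p : ℂ[X]) (k : ℕ) (z : ℂ) :
    iteratedDeriv k (fun w => p.eval w) z = ((Polynomial.derivative^[k]) p).eval z := by
  induction k generalizing p with
  | zero => simp
  | succ k ih =>
    rw [iteratedDeriv_succ', Function.iterate_succ_apply, ← ih]
    congr 1
    ext w
    simp

theorem matrixFunction_eval {n : ℕ} (p : ℂ[X]) (A : Matrix (Fin n) (Fin n) ℂ) :
    matrixFunction (fun z => p.eval z) A = Polynomial.aeval A p :=
  matrixFunction_eq_aeval _ A p fun z k _ => (p.iteratedDeriv_eval k z).symm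

/-- By the Leibniz rule the product of two interpolants interpolates the product; analyticity makes
the rule available. -/
theorem matrixFunction_mul {n : ℕ} {f g : ℂ → ℂ} {A : Matrix (Fin n) (Fin n) ℂ}
    (hf : ∀ z, (minpoly ℂ A).IsRoot z → AnalyticAt ℂ f z)
    (hg : ∀ z, (minpoly ℂ A).IsRoot z → AnalyticAt ℂ g z) :
    matrixFunction (fun z => f z * g z) A = matrixFunction f A * matrixFunction g A := by
  have hq : minpoly ℂ A ≠ 0 := minpoly.ne_zero (Algebra.IsIntegral.isIntegral A)
  obtain ⟨p, hp⟩ := exists_hermite_interpolant (minpoly ℂ A) f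
  obtain ⟨r, hr⟩ := exists_hermite_interpolant (minpoly ℂ A) g
  rw [matrixFunction_eq_aeval f A p hp, matrixFunction_eq_aeval g A r hr, ← map_mul]
  refine matrixFunction_eq_aeval _ A _ fun z k hk => ?_
  have hz := (Polynomial.rootMultiplicity_pos hq).1 (Nat.zero_lt_of_lt hk)
  rw [← Polynomial.iteratedDeriv_eval]
  have e1 : (fun w => (p * r).eval w) = (fun w => p.eval w) * (fun w => r.eval w) := by
    ext w; simp
  have e2 : (fun w => f w * g w) = f * g := rfl
  rw [e1, e2, iteratedDeriv_mul p.differentiable.contDiff.contDiffAt r.differentiable.contDiff.contDiffAt,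
    iteratedDeriv_mul (hf z hz).contDiffAt (hg z hz).contDiffAt]
  refine Finset.sum_congr rfl fun i hi => ?_
  rw [Finset.mem_range] at hi
  rw [Polynomial.iteratedDeriv_eval, Polynomial.iteratedDeriv_eval, hp z i (by omega),
    hr z (k - i) (by omega)]

/-- A matrix function depends linearly on the jets of `f` at the eigenvalues. -/
theorem exists_matrixFunction_eq_sum {n : ℕ} (A : Matrix (Fin n) (Fin n) ℂ) :
    ∃ E : ((z : (minpoly ℂ A).roots.toFinset) × Fin ((minpoly ℂ A).rootMultiplicity (z : ℂ))) →
        Matrix (Fin n) (Fin n) ℂ,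
      ∀ f : ℂ → ℂ, matrixFunction f A = ∑ i, iteratedDeriv (i.2 : ℕ) f (i.1 : ℂ) • E i := by
  classical
  have hq : minpoly ℂ A ≠ 0 := minpoly.ne_zero (Algebra.IsIntegral.isIntegral A)
  let D : ℂ[X] →ₗ[ℂ] ((z : (minpoly ℂ A).roots.toFinset) ×
      Fin ((minpoly ℂ A).rootMultiplicity (z : ℂ))) → ℂ :=
    LinearMap.pi fun i => (Polynomial.leval (i.1 : ℂ)) ∘ₗ (Polynomial.derivative ^ (i.2 : ℕ))
  have hD (p : ℂ[X]) i : D p i = ((Polynomial.derivative^[(i.2 : ℕ)]) p).eval (i.1 : ℂ) := by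
    simp [D, Module.End.pow_apply]
  have hroot (z : ℂ) (k : ℕ) (hk : k < (minpoly ℂ A).rootMultiplicity z) :
      z ∈ (minpoly ℂ A).roots.toFinset := by
    rw [Multiset.mem_toFinset, ← Multiset.count_pos, Polynomial.count_roots]
    omega
  -- Evaluation at `A` kills polynomials with zero jets, so it factors through the jet map `D`; `L`
  -- extends this factor from the range of `D` to all jets.
  have hker : LinearMap.ker D ≤ LinearMap.ker (Polynomial.aeval (R := ℂ) A).toLinearMap := by
    intro p hp
    rw [LinearMap.mem_ker] at hp ⊢
    have h1 : matrixFunction (fun z => (0 : ℂ[X]).eval z) A = Polynomial.aeval A p := by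
      refine matrixFunction_eq_aeval _ A p fun z k hk => ?_
      rw [Polynomial.iteratedDeriv_eval, Polynomial.iterate_derivative_zero, Polynomial.eval_zero,
        ← hD p ⟨⟨z, hroot z k hk⟩, ⟨k, hk⟩⟩, hp, Pi.zero_apply]
    rw [matrixFunction_eval, map_zero] at h1
    exact h1.symm
  obtain ⟨L, hL⟩ : ∃ L : (_ → ℂ) →ₗ[ℂ] Matrix (Fin n) (Fin n) ℂ,
      L ∘ₗ D = (Polynomial.aeval (R := ℂ) A).toLinearMap := by
    obtain ⟨s, hs⟩ := D.rangeRestrict.exists_rightInverse_of_surjective D.range_rangeRestrict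
    obtain ⟨L, hL⟩ := ((Polynomial.aeval (R := ℂ) A).toLinearMap ∘ₗ s).exists_extend
    refine ⟨L, LinearMap.ext fun p => ?_⟩
    have h1 : L (D p) = (Polynomial.aeval (R := ℂ) A).toLinearMap (s (D.rangeRestrict p)) :=
      LinearMap.congr_fun hL (D.rangeRestrict p)
    rw [LinearMap.comp_apply, h1, ← sub_eq_zero, ← map_sub, ← LinearMap.mem_ker]
    apply hker
    have h2 : D (s (D.rangeRestrict p)) = D p :=
      congrArg Subtype.val (LinearMap.congr_fun hs (D.rangeRestrict p))
    rw [LinearMap.mem_ker, map_sub, h2, sub_self]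
  refine ⟨fun i => L (Pi.single i 1), fun f => ?_⟩
  obtain ⟨p, hp⟩ := exists_hermite_interpolant (minpoly ℂ A) f
  rw [matrixFunction_eq_aeval f A p hp]
  have h1 : Polynomial.aeval A p = L (D p) := (LinearMap.congr_fun hL p).symm
  have h2 : D p = ∑ i, iteratedDeriv (i.2 : ℕ) f (i.1 : ℂ) • Pi.single i (1 : ℂ) := by
    ext j
    rw [hD, hp _ _ j.2.2, Finset.sum_apply]
    simp [Pi.single_apply]
  rw [h1, h2, map_sum]
  simp only [map_smul]

/-! ### Integral representation of principal powers. -/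

section PowerIntegral

open Complex MeasureTheory Set Filter Topology

theorem Complex.exists_mul_one_add_le_norm_add {z₀ : ℂ} (hz : z₀ ∈ slitPlane) :
    ∃ U ∈ 𝓝 z₀, ∃ c > 0, ∀ z ∈ U, z ∈ slitPlane ∧ ‖z‖ ≤ ‖z₀‖ + 1 ∧
      ∀ s : ℝ, 0 ≤ s → c * (1 + s) ≤ ‖z + s‖ := by
  obtain ⟨d, hd, hball⟩ := Metric.isOpen_iff.1 isOpen_slitPlane z₀ hz
  refine ⟨Metric.ball z₀ (min (d / 2) 1), Metric.ball_mem_nhds _ (by positivity),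
    -- From `d ≤ ‖z₀ + s‖` (as `-s` lies off the slit plane) and `s ≤ ‖z₀ + s‖ + ‖z₀‖` one gets `1 +
    -- s ≤ (1 + (1 + ‖z₀‖) / d) ‖z₀ + s‖`; passing from `z₀` to `z` costs the factor 2.
    (2 * (1 + (1 + ‖z₀‖) / d))⁻¹, by positivity, fun z hzU => ?_⟩
  rw [Metric.mem_ball, dist_eq_norm] at hzU
  have h1 := hzU.trans_le (min_le_left _ _)
  have h2 := hzU.trans_le (min_le_right _ _)
  refine ⟨hball ?_, ?_, fun s hs => ?_⟩
  · rw [Metric.mem_ball, dist_eq_norm]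
    linarith
  · have := norm_add_le z₀ (z - z₀)
    rw [add_sub_cancel] at this
    linarith
  have h3 : d ≤ ‖z₀ + s‖ := by
    by_contra! hlt
    have : (-(s : ℂ)) ∈ slitPlane := hball (by
      rw [Metric.mem_ball, dist_eq_norm, ← norm_neg]
      simpa [add_comm] using hlt)
    rw [mem_slitPlane_iff] at this
    simp at this
    linarith
  have h4 : s ≤ ‖z₀ + s‖ + ‖z₀‖ := by
    have := norm_sub_le (z₀ + s) z₀
    rw [add_sub_cancel_left, norm_real, Real.norm_of_nonneg hs] at this
    exact this
  have h5 : ‖z₀ + s‖ ≤ 2 * ‖z + s‖ := by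
    have := norm_sub_le (z + s) (z - z₀)
    rw [show z + s - (z - z₀) = z₀ + s by ring] at this
    linarith
  rw [inv_mul_le_iff₀ (by positivity)]
  have h6 : 1 + ‖z₀‖ ≤ (1 + ‖z₀‖) / d * ‖z₀ + s‖ := by
    rw [div_mul_eq_mul_div, le_div_iff₀ hd]
    gcongr
  have h7 : (1 + (1 + ‖z₀‖) / d) * ‖z₀ + s‖ ≤ (1 + (1 + ‖z₀‖) / d) * (2 * ‖z + s‖) := by
    gcongr
  linarith

/-- The derivative of order `k` in `z` of `s ^ (p - 1) * z / (z + s)`. -/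
noncomputable def powerKernel (p : ℝ) : ℕ → ℝ → ℂ → ℂ
  | 0, s, z => (s ^ (p - 1) : ℝ) * (z / (z + s))
  | k + 1, s, z => (-1) ^ k * (k + 1).factorial * (s ^ p : ℝ) * ((z + s) ^ (k + 2))⁻¹

/-- Since `z / (z + s) = 1 - s / (z + s)`, differentiation brings out one factor `s`, whence `s ^ p`
in every positive order. -/
theorem hasDerivAt_powerKernel (p : ℝ) (k : ℕ) {s : ℝ} (hs : 0 < s) {z : ℂ} (hz : z + s ≠ 0) :
    HasDerivAt (powerKernel p k s) (powerKernel p (k + 1) s z) z := by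
  have h1 : HasDerivAt (fun w : ℂ => w + s) 1 z := (hasDerivAt_id z).add_const _
  cases k with
  | zero =>
    have h2 := ((hasDerivAt_id z).div h1 hz).const_mul ((s ^ (p - 1) : ℝ) : ℂ)
    refine h2.congr_deriv ?_
    have : s ^ p = s ^ (p - 1) * s := by
      rw [← Real.rpow_add_one hs.ne', sub_add_cancel]
    simp only [powerKernel, this, id]
    push_cast
    field_simp
    simp
  | succ k =>
    have h2 := ((h1.pow (k + 2)).inv (pow_ne_zero _ hz)).const_mul
      ((-1) ^ k * ((k + 1).factorial : ℂ) * (s ^ p : ℝ))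
    refine h2.congr_deriv ?_
    simp only [powerKernel, Nat.factorial_succ (k + 1)]
    push_cast
    field_simp
    simp
    ring

theorem Complex.slitPlane_add_ofReal_ne_zero {z : ℂ} (hz : z ∈ slitPlane) {s : ℝ} (hs : 0 ≤ s) :
    z + s ≠ 0 := by
  intro h
  rw [eq_neg_of_add_eq_zero_left h, mem_slitPlane_iff] at hz
  simp at hz
  linarith

theorem iteratedDeriv_powerKernel (p : ℝ) (k : ℕ) {s : ℝ} (hs : 0 < s) {z : ℂ}
    (hz : z ∈ slitPlane) : iteratedDeriv k (powerKernel p 0 s) z = powerKernel p k s z := by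
  induction k generalizing z with
  | zero => simp
  | succ k ih =>
    rw [iteratedDeriv_succ, EventuallyEq.deriv_eq (f := powerKernel p k s)]
    · exact (hasDerivAt_powerKernel p k hs (slitPlane_add_ofReal_ne_zero hz hs.le)).deriv
    · filter_upwards [isOpen_slitPlane.mem_nhds hz] with w hw using ih hw

theorem aestronglyMeasurable_powerKernel (p : ℝ) (k : ℕ) {z : ℂ} (hz : z ∈ slitPlane) :
    AEStronglyMeasurable (fun s => powerKernel p k s z) (volume.restrict (Ioi 0)) := by
  refine ContinuousOn.aestronglyMeasurable ?_ measurableSet_Ioi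
  have h1 (q : ℝ) : ContinuousOn (fun s : ℝ => ((s ^ q : ℝ) : ℂ)) (Ioi 0) :=
    continuous_ofReal.comp_continuousOn
      (continuousOn_id.rpow_const fun s hs => Or.inl (ne_of_gt hs))
  have h2 : ContinuousOn (fun s : ℝ => z + s) (Ioi 0) := by fun_prop
  cases k with
  | zero =>
    exact (h1 _).mul (continuousOn_const.div h2
      fun s hs => slitPlane_add_ofReal_ne_zero hz (le_of_lt hs))
  | succ k =>
    exact (continuousOn_const.mul (h1 _)).mul ((h2.pow _).inv₀
      fun s hs => pow_ne_zero _ (slitPlane_add_ofReal_ne_zero hz (le_of_lt hs)))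

/-- The single integrable function `s^(p-1) / (1 + s)` dominates all orders locally uniformly in
`z`, which permits differentiation under the integral. -/
theorem exists_norm_powerKernel_le {p : ℝ} (hp : p ∈ Ioo (0 : ℝ) 1) (k : ℕ) {z₀ : ℂ}
    (hz : z₀ ∈ slitPlane) :
    ∃ U ∈ 𝓝 z₀, U ⊆ slitPlane ∧ ∃ K : ℝ, ∀ z ∈ U, ∀ s : ℝ, 0 < s →
      ‖powerKernel p k s z‖ ≤ K * Real.rpowIntegrand₀₁ p s 1 := by
  obtain ⟨U, hU, c, hc, h⟩ := exists_mul_one_add_le_norm_add hz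
  cases k with
  | zero =>
    refine ⟨U, hU, fun z hz => (h z hz).1, (‖z₀‖ + 1) / c, fun z hz s hs => ?_⟩
    obtain ⟨-, h1, h2⟩ := h z hz
    rw [Real.rpowIntegrand₀₁_eq_pow_div hp hs.le zero_le_one]
    simp only [powerKernel, norm_mul, norm_div, norm_real]
    rw [Real.norm_of_nonneg (by positivity)]
    calc s ^ (p - 1) * (‖z‖ / ‖z + s‖) ≤ s ^ (p - 1) * ((‖z₀‖ + 1) / (c * (1 + s))) := by
          have := h2 s hs.le
          gcongr
      _ = _ := by field_simp; ring
  | succ k =>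
    refine ⟨U, hU, fun z hz => (h z hz).1, (k + 1).factorial / c ^ (k + 2), fun z hz s hs => ?_⟩
    obtain ⟨-, -, h2⟩ := h z hz
    rw [Real.rpowIntegrand₀₁_eq_pow_div hp hs.le zero_le_one]
    simp only [powerKernel, norm_mul, norm_inv, norm_pow, norm_real, norm_neg, norm_one, one_pow,
      one_mul, norm_natCast]
    rw [Real.norm_of_nonneg (by positivity)]
    have h3 : s ^ p * (1 + s) ≤ s ^ (p - 1) * (1 + s) ^ (k + 2) := by
      have e : s ^ p = s ^ (p - 1) * s := by
        rw [← Real.rpow_add_one hs.ne', sub_add_cancel]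
      have h5 : (1 : ℝ) ≤ (1 + s) ^ k := one_le_pow₀ (by linarith)
      rw [e, mul_assoc]
      gcongr
      calc s * (1 + s) ≤ (1 + s) ^ 2 * 1 := by nlinarith
        _ ≤ (1 + s) ^ 2 * (1 + s) ^ k := by gcongr
        _ = _ := by ring
    calc (k + 1).factorial * s ^ p * (‖z + s‖ ^ (k + 2))⁻¹
        ≤ (k + 1).factorial * s ^ p * ((c * (1 + s)) ^ (k + 2))⁻¹ := by
          have := h2 s hs.le
          gcongr
      _ ≤ _ := by
          rw [← div_eq_mul_inv, div_mul_div_comm, div_le_div_iff₀ (by positivity) (by positivity),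
            mul_pow]
          have := mul_le_mul_of_nonneg_left h3
            (show 0 ≤ ((k + 1).factorial : ℝ) * c ^ (k + 2) by positivity)
          linarith

theorem integrableOn_powerKernel {p : ℝ} (hp : p ∈ Ioo (0 : ℝ) 1) (k : ℕ) {z : ℂ}
    (hz : z ∈ slitPlane) : IntegrableOn (fun s => powerKernel p k s z) (Ioi 0) := by
  obtain ⟨U, hU, -, K, hK⟩ := exists_norm_powerKernel_le hp k hz
  refine ((Real.integrableOn_rpowIntegrand₀₁_Ioi hp zero_le_one).const_mul K).mono'
    (aestronglyMeasurable_powerKernel p k hz) ?_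
  filter_upwards [ae_restrict_mem measurableSet_Ioi] with s hs using hK z (mem_of_mem_nhds hU) s hs

theorem hasDerivAt_integral_powerKernel {p : ℝ} (hp : p ∈ Ioo (0 : ℝ) 1) (k : ℕ) {z : ℂ}
    (hz : z ∈ slitPlane) :
    HasDerivAt (fun w => ∫ s in Ioi 0, powerKernel p k s w)
      (∫ s in Ioi 0, powerKernel p (k + 1) s z) z := by
  obtain ⟨U, hU, hUs, K, hK⟩ := exists_norm_powerKernel_le hp (k + 1) hz
  refine (hasDerivAt_integral_of_dominated_loc_of_deriv_le (𝕜 := ℂ)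
    (μ := volume.restrict (Ioi 0)) (F := fun w s => powerKernel p k s w)
    (F' := fun w s => powerKernel p (k + 1) s w)
    (bound := fun s => K * Real.rpowIntegrand₀₁ p s 1) hU ?_
    (integrableOn_powerKernel hp k hz) (aestronglyMeasurable_powerKernel p (k + 1) hz) ?_
    ((Real.integrableOn_rpowIntegrand₀₁_Ioi hp zero_le_one).const_mul K) ?_).2
  · filter_upwards [isOpen_slitPlane.mem_nhds hz] with w hw
      using aestronglyMeasurable_powerKernel p k hw
  · filter_upwards [ae_restrict_mem measurableSet_Ioi] with s hs w hw using hK w hw s hs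
  · filter_upwards [ae_restrict_mem measurableSet_Ioi] with s hs w hw
    exact hasDerivAt_powerKernel p k hs
      (slitPlane_add_ofReal_ne_zero (hUs hw) (le_of_lt hs))

theorem iteratedDeriv_integral_powerKernel {p : ℝ} (hp : p ∈ Ioo (0 : ℝ) 1) (k : ℕ) {z : ℂ}
    (hz : z ∈ slitPlane) :
    iteratedDeriv k (fun w => ∫ s in Ioi 0, powerKernel p 0 s w) z =
      ∫ s in Ioi 0, powerKernel p k s z := by
  induction k generalizing z with
  | zero => simp
  | succ k ih =>
    rw [iteratedDeriv_succ, EventuallyEq.deriv_eq (f := fun w => ∫ s in Ioi 0, powerKernel p k s w)]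
    · exact (hasDerivAt_integral_powerKernel hp k hz).deriv
    · filter_upwards [isOpen_slitPlane.mem_nhds hz] with w hw using ih hw

/-- The normalizing constant of the integral representation of `z ↦ z ^ p`. -/
noncomputable def powerConst (p : ℝ) : ℝ := (∫ s in Ioi 0, Real.rpowIntegrand₀₁ p s 1)⁻¹

theorem powerConst_pos {p : ℝ} (hp : p ∈ Ioo (0 : ℝ) 1) : 0 < powerConst p :=
  inv_pos.2 (Real.integral_rpowIntegrand₀₁_one_pos hp)

/-- Identity theorem: both sides are analytic on the connected slit plane and agree at real points
near 1. -/
theorem Complex.cpow_eq_integral_powerKernel {p : ℝ} (hp : p ∈ Ioo (0 : ℝ) 1) {z : ℂ}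
    (hz : z ∈ slitPlane) :
    z ^ (p : ℂ) = powerConst p * ∫ s in Ioi 0, powerKernel p 0 s z := by
  have hF : AnalyticOnNhd ℂ (fun w => powerConst p * ∫ s in Ioi 0, powerKernel p 0 s w)
      slitPlane := by
    refine DifferentiableOn.analyticOnNhd (fun w hw => ?_) isOpen_slitPlane
    exact ((hasDerivAt_integral_powerKernel hp 0 hw).const_mul
      (powerConst p : ℂ)).differentiableAt.differentiableWithinAt
  have hG : AnalyticOnNhd ℂ (fun w : ℂ => w ^ (p : ℂ)) slitPlane :=
    fun w hw => analyticAt_id.cpow analyticAt_const hw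
  have hconn : IsPreconnected slitPlane :=
    (starConvex_one_slitPlane.isPathConnected one_mem_slitPlane).isConnected.isPreconnected
  refine hG.eqOn_of_preconnected_of_frequently_eq hF hconn one_mem_slitPlane ?_ hz
  have ht : Tendsto (fun x : ℝ => (x : ℂ)) (𝓝[≠] 1) (𝓝[≠] 1) := by
    refine tendsto_nhdsWithin_iff.2 ⟨?_, ?_⟩
    · have : Tendsto (fun x : ℝ => (x : ℂ)) (𝓝 1) (𝓝 ((1 : ℝ) : ℂ)) :=
        continuous_ofReal.tendsto 1
      rw [ofReal_one] at this
      exact this.mono_left nhdsWithin_le_nhds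
    · filter_upwards [self_mem_nhdsWithin] with x hx
      simpa using hx
  refine ht.frequently (Eventually.frequently ?_)
  filter_upwards [nhdsWithin_le_nhds (Ioi_mem_nhds (zero_lt_one (α := ℝ)))] with x hx
  rw [← ofReal_cpow (le_of_lt hx), Real.rpow_eq_const_mul_integral hp (le_of_lt hx), powerConst,
    ofReal_mul]
  congr 1
  rw [← integral_complex_ofReal]
  refine setIntegral_congr_fun measurableSet_Ioi fun s hs => ?_
  simp only [powerKernel]
  rw [Real.rpowIntegrand₀₁_eq_pow_div hp (le_of_lt hs) (le_of_lt hx)]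
  push_cast
  rw [add_comm (s : ℂ), mul_div_assoc]

theorem iteratedDeriv_cpow_eq_integral {p : ℝ} (hp : p ∈ Ioo (0 : ℝ) 1) (k : ℕ) {z : ℂ}
    (hz : z ∈ slitPlane) :
    iteratedDeriv k (fun w : ℂ => w ^ (p : ℂ)) z =
      powerConst p * ∫ s in Ioi 0, powerKernel p k s z := by
  rw [← iteratedDeriv_integral_powerKernel hp k hz, ← iteratedDeriv_const_mul_field]
  refine EventuallyEq.iteratedDeriv_eq k ?_
  filter_upwards [isOpen_slitPlane.mem_nhds hz] with w hw
    using cpow_eq_integral_powerKernel hp hw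

theorem matrixFunction_powerKernel {n : ℕ} {T : Matrix (Fin n) (Fin n) ℂ}
    (hT : ∀ z, (minpoly ℂ T).IsRoot z → z ∈ slitPlane) (p : ℝ) {s : ℝ} (hs : 0 < s) :
    matrixFunction (powerKernel p 0 s) T * (T + (s : ℂ) • 1) = ((s ^ (p - 1) : ℝ) : ℂ) • T := by
  have h1 : matrixFunction (fun z => (Polynomial.X + Polynomial.C (s : ℂ)).eval z) T =
      T + (s : ℂ) • 1 := by
    rw [matrixFunction_eval]
    simp [Algebra.algebraMap_eq_smul_one]
  have h2 : matrixFunction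
      (fun z => (Polynomial.C ((s ^ (p - 1) : ℝ) : ℂ) * Polynomial.X).eval z) T =
      ((s ^ (p - 1) : ℝ) : ℂ) • T := by
    rw [matrixFunction_eval]
    simp [Algebra.algebraMap_eq_smul_one]
  rw [← h1, ← h2, ← matrixFunction_mul]
  · refine matrixFunction_congr fun z hz => ?_
    filter_upwards [isOpen_slitPlane.mem_nhds (hT z hz)] with w hw
    have := slitPlane_add_ofReal_ne_zero hw hs.le
    simp [powerKernel]
    field_simp
  · intro z hz
    have h3 : DifferentiableOn ℂ (powerKernel p 0 s) slitPlane := fun w hw =>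
      (hasDerivAt_powerKernel p 0 hs
        (slitPlane_add_ofReal_ne_zero hw hs.le)).differentiableAt.differentiableWithinAt
    exact h3.analyticOnNhd isOpen_slitPlane z (hT z hz)
  · exact fun z _ => (Polynomial.differentiable _).analyticAt z

/-- A matrix function is a finite combination of jets at eigenvalues, so the scalar formula and its
derivatives suffice. Testing with `l` keeps the integrals scalar. -/
theorem map_matrixPower_eq_integral {n : ℕ} {T : Matrix (Fin n) (Fin n) ℂ}
    (hT : ∀ z, (minpoly ℂ T).IsRoot z → z ∈ slitPlane) {p : ℝ} (hp : p ∈ Ioo (0 : ℝ) 1)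
    (l : Matrix (Fin n) (Fin n) ℂ →ₗ[ℂ] ℂ) :
    IntegrableOn (fun s => l (matrixFunction (powerKernel p 0 s) T)) (Ioi 0) ∧
      l (matrixPower T p) =
        powerConst p * ∫ s in Ioi 0, l (matrixFunction (powerKernel p 0 s) T) := by
  obtain ⟨E, hE⟩ := exists_matrixFunction_eq_sum T
  have hroot (i : (z : (minpoly ℂ T).roots.toFinset) ×
      Fin ((minpoly ℂ T).rootMultiplicity (z : ℂ))) : (i.1 : ℂ) ∈ slitPlane :=
    hT _ (Polynomial.isRoot_of_mem_roots (Multiset.mem_toFinset.1 i.1.2))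
  have h1 : EqOn (fun s => l (matrixFunction (powerKernel p 0 s) T))
      (fun s => ∑ i, powerKernel p i.2 s i.1 * l (E i)) (Ioi 0) := fun s hs => by
    simp only [hE, map_sum, map_smul, smul_eq_mul]
    exact Finset.sum_congr rfl fun i _ => by rw [iteratedDeriv_powerKernel p _ hs (hroot i)]
  have h2 i : IntegrableOn (fun s => powerKernel p i.2 s i.1 * l (E i)) (Ioi 0) :=
    (integrableOn_powerKernel hp i.2 (hroot i)).mul_const _
  constructor
  · refine IntegrableOn.congr_fun ?_ h1.symm measurableSet_Ioi
    exact integrable_finsetSum _ fun i _ => h2 i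
  · rw [setIntegral_congr_fun measurableSet_Ioi h1, integral_finsetSum _ fun i _ => h2 i,
      matrixPower, hE, map_sum, Finset.mul_sum]
    refine Finset.sum_congr rfl fun i _ => ?_
    rw [map_smul, iteratedDeriv_cpow_eq_integral hp _ (hroot i), integral_mul_const, smul_eq_mul,
      mul_assoc]

end PowerIntegral

/-! ### Spectra and powers of accretive matrices. -/

theorem exists_mulVec_eq_smul_of_isRoot_minpoly {n : ℕ} {A : Matrix (Fin n) (Fin n) ℂ} {z : ℂ}
    (hz : (minpoly ℂ A).IsRoot z) : ∃ v ≠ 0, A *ᵥ v = z • v := by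
  rw [← Matrix.minpoly_toLin', ← Module.End.hasEigenvalue_iff_isRoot] at hz
  obtain ⟨v, hv⟩ := hz.exists_hasEigenvector
  exact ⟨v, hv.2, by simpa using hv.apply_eq_smul⟩

theorem re_dotProduct_realPart_mulVec {m : Type*} [Fintype m] (A : Matrix m m ℂ) (x : m → ℂ) :
    (star x ⬝ᵥ (ℜ A : Matrix m m ℂ) *ᵥ x).re = (star x ⬝ᵥ A *ᵥ x).re := by
  have h : (star x ⬝ᵥ Aᴴ *ᵥ x) = star (star x ⬝ᵥ A *ᵥ x) := by
    rw [Matrix.dotProduct_mulVec, ← Matrix.star_mulVec, Matrix.star_dotProduct]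
  rw [realPart_apply_coe, Matrix.star_eq_conjTranspose, Matrix.smul_mulVec, dotProduct_smul,
    Matrix.add_mulVec, dotProduct_add, h]
  simp
  ring

theorem IsAccretive.re_nonneg {m : Type*} [Fintype m] {A : Matrix m m ℂ} (hA : IsAccretive A)
    (x : m → ℂ) : 0 ≤ (star x ⬝ᵥ A *ᵥ x).re := by
  rw [← re_dotProduct_realPart_mulVec]
  exact hA.re_dotProduct_nonneg x

theorem IsStrictlyAccretive.re_pos {m : Type*} [Fintype m] {A : Matrix m m ℂ}
    (hA : IsStrictlyAccretive A) {x : m → ℂ} (hx : x ≠ 0) : 0 < (star x ⬝ᵥ A *ᵥ x).re := by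
  rw [← re_dotProduct_realPart_mulVec]
  exact hA.re_dotProduct_pos hx

-- A real `z ≤ 0` would give `Re⟨v, Bv⟩ = z Re⟨v, Av⟩ ≤ 0`.
open Complex in
theorem IsStrictlyAccretive.mem_slitPlane {n : ℕ} {A B : Matrix (Fin n) (Fin n) ℂ}
    (hA : IsStrictlyAccretive A) (hB : IsStrictlyAccretive B) {v : Fin n → ℂ} (hv : v ≠ 0) {z : ℂ}
    (h : B *ᵥ v = z • A *ᵥ v) : z ∈ slitPlane := by
  have h1 := hA.re_pos hv
  have h2 := hB.re_pos hv
  by_contra hz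
  rw [mem_slitPlane_iff] at hz
  push Not at hz
  rw [h, dotProduct_smul, smul_eq_mul, mul_re, hz.2, zero_mul, sub_zero] at h2
  nlinarith [hz.1]

theorem isStrictlyAccretive_one {n : ℕ} :
    IsStrictlyAccretive (1 : Matrix (Fin n) (Fin n) ℂ) := by
  have : (ℜ (1 : Matrix (Fin n) (Fin n) ℂ) : Matrix (Fin n) (Fin n) ℂ) = 1 :=
    (IsSelfAdjoint.one _).coe_realPart
  rw [IsStrictlyAccretive, this]
  exact Matrix.PosDef.one

open Complex in
theorem IsStrictlyAccretive.mem_slitPlane_of_isRoot {n : ℕ} {A : Matrix (Fin n) (Fin n) ℂ}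
    (hA : IsStrictlyAccretive A) {z : ℂ} (hz : (minpoly ℂ A).IsRoot z) : z ∈ slitPlane := by
  obtain ⟨v, hv, h⟩ := exists_mulVec_eq_smul_of_isRoot_minpoly hz
  exact isStrictlyAccretive_one.mem_slitPlane hA hv (by rw [h, Matrix.one_mulVec])

theorem IsStrictlyAccretive.isUnit_add_smul {n : ℕ} {A B : Matrix (Fin n) (Fin n) ℂ}
    (hA : IsStrictlyAccretive A) (hB : IsStrictlyAccretive B) {s : ℝ} (hs : 0 ≤ s) :
    IsUnit (B + (s : ℂ) • A) := by
  rw [← Matrix.mulVec_injective_iff_isUnit]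
  refine (injective_iff_map_eq_zero (Matrix.mulVecLin (B + (s : ℂ) • A))).2 fun v hv => ?_
  by_contra hv0
  rw [Matrix.mulVecLin_apply, Matrix.add_mulVec, Matrix.smul_mulVec] at hv
  have := hA.mem_slitPlane hB hv0 (z := -(s : ℂ)) (by rw [neg_smul]; exact eq_neg_of_add_eq_zero_left hv)
  rw [Complex.mem_slitPlane_iff] at this
  simp at this
  linarith

theorem matrixPower_zero {n : ℕ} (A : Matrix (Fin n) (Fin n) ℂ) : matrixPower A 0 = 1 := by
  have : (fun z : ℂ => z ^ ((0 : ℝ) : ℂ)) = fun z => (1 : ℂ[X]).eval z := by ext z; simp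
  rw [matrixPower, this, matrixFunction_eval, map_one]

theorem matrixPower_one {n : ℕ} (A : Matrix (Fin n) (Fin n) ℂ) : matrixPower A 1 = A := by
  have : (fun z : ℂ => z ^ ((1 : ℝ) : ℂ)) = fun z => (Polynomial.X : ℂ[X]).eval z := by ext z; simp
  rw [matrixPower, this, matrixFunction_eval, Polynomial.aeval_X]

open Complex in
theorem matrixPower_mul_matrixPower {n : ℕ} {A : Matrix (Fin n) (Fin n) ℂ}
    (hA : ∀ z, (minpoly ℂ A).IsRoot z → z ∈ slitPlane) (r s : ℝ) :
    matrixPower A r * matrixPower A s = matrixPower A (r + s) := by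
  have h (q : ℝ) : ∀ z, (minpoly ℂ A).IsRoot z → AnalyticAt ℂ (fun w => w ^ (q : ℂ)) z :=
    fun z hz => analyticAt_id.cpow analyticAt_const (hA z hz)
  rw [matrixPower, matrixPower, ← matrixFunction_mul (h r) (h s)]
  refine matrixFunction_congr fun z hz => ?_
  filter_upwards [isOpen_slitPlane.mem_nhds (hA z hz)] with w hw
  rw [ofReal_add, cpow_add _ _ (slitPlane_ne_zero hw)]

theorem IsStrictlyAccretive.matrixPower_half_mul_self {n : ℕ}
    {A : Matrix (Fin n) (Fin n) ℂ} (hA : IsStrictlyAccretive A) :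
    matrixPower A (1 / 2) * matrixPower A (1 / 2) = A := by
  rw [matrixPower_mul_matrixPower fun z => hA.mem_slitPlane_of_isRoot, add_halves, matrixPower_one]

theorem IsStrictlyAccretive.matrixPower_half_mul_neg_half {n : ℕ}
    {A : Matrix (Fin n) (Fin n) ℂ} (hA : IsStrictlyAccretive A) :
    matrixPower A (1 / 2) * matrixPower A (-(1 / 2)) = 1 := by
  rw [matrixPower_mul_matrixPower fun z => hA.mem_slitPlane_of_isRoot, add_neg_cancel,
    matrixPower_zero]

theorem IsStrictlyAccretive.matrixPower_neg_half_mul_half {n : ℕ}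
    {A : Matrix (Fin n) (Fin n) ℂ} (hA : IsStrictlyAccretive A) :
    matrixPower A (-(1 / 2)) * matrixPower A (1 / 2) = 1 := by
  rw [matrixPower_mul_matrixPower fun z => hA.mem_slitPlane_of_isRoot, neg_add_cancel,
    matrixPower_zero]

theorem geomMean_zero {n : ℕ} {A : Matrix (Fin n) (Fin n) ℂ} (hA : IsStrictlyAccretive A)
    (B : Matrix (Fin n) (Fin n) ℂ) : geomMean 0 A B = A := by
  rw [geomMean, matrixPower_zero, mul_one, hA.matrixPower_half_mul_self]

theorem geomMean_one {n : ℕ} {A : Matrix (Fin n) (Fin n) ℂ} (hA : IsStrictlyAccretive A)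
    (B : Matrix (Fin n) (Fin n) ℂ) : geomMean 1 A B = B := by
  rw [geomMean, matrixPower_one, ← mul_assoc, ← mul_assoc, hA.matrixPower_half_mul_neg_half,
    one_mul, mul_assoc, hA.matrixPower_neg_half_mul_half, mul_one]

-- If `v` is an eigenvector of `A^(-1/2) B A^(-1/2)`, then `A^(-1/2) v` solves `B w = z A w`.
open Complex in
theorem mem_slitPlane_of_isRoot_minpoly_conj {n : ℕ} {A B : Matrix (Fin n) (Fin n) ℂ}
    (hA : IsStrictlyAccretive A) (hB : IsStrictlyAccretive B) {z : ℂ}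
    (hz : (minpoly ℂ (matrixPower A (-(1 / 2)) * B * matrixPower A (-(1 / 2)))).IsRoot z) :
    z ∈ slitPlane := by
  obtain ⟨v, hv, h⟩ := exists_mulVec_eq_smul_of_isRoot_minpoly hz
  set Q := matrixPower A (-(1 / 2))
  set R := matrixPower A (1 / 2)
  have hRQ : R * Q = 1 := hA.matrixPower_half_mul_neg_half
  have hRR : R * R = A := hA.matrixPower_half_mul_self
  refine hA.mem_slitPlane hB (v := Q *ᵥ v) (fun h0 => hv ?_) ?_
  · rw [← Matrix.one_mulVec v, ← hRQ, ← Matrix.mulVec_mulVec, h0, Matrix.mulVec_zero]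
  · have := congrArg (R *ᵥ ·) h
    simp only [Matrix.mulVec_smul, Matrix.mulVec_mulVec] at this
    rw [← mul_assoc, ← mul_assoc, hRQ, one_mul] at this
    rw [Matrix.mulVec_mulVec, Matrix.mulVec_mulVec, this, ← hRR, mul_assoc, hRQ, mul_one]

/-! ### Integral form of the geometric mean. -/

-- The kernel at `T`, multiplied by `A^(1/2)` on both sides, is `s^(p-1) B (B + sA)⁻¹ A`. With `g =
-- (B + sA)⁻¹ A x` and `u = x - s g` one has `A u = B g`, so `⟨x, Bg⟩ = ⟨u, Au⟩ + s ⟨g, Bg⟩`.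
open MeasureTheory Set in
theorem re_geomMean_eq_integral {n : ℕ} {A B : Matrix (Fin n) (Fin n) ℂ}
    (hA : IsStrictlyAccretive A) (hB : IsStrictlyAccretive B) {p : ℝ} (hp : p ∈ Ioo (0 : ℝ) 1)
    (x : Fin n → ℂ) :
    ∃ u g : ℝ → Fin n → ℂ, (∀ s > 0, u s + (s : ℂ) • g s = x) ∧
      IntegrableOn (fun s => s ^ (p - 1) *
        ((star (u s) ⬝ᵥ A *ᵥ u s).re + s * (star (g s) ⬝ᵥ B *ᵥ g s).re)) (Ioi 0) ∧
      (star x ⬝ᵥ geomMean p A B *ᵥ x).re = powerConst p * ∫ s in Ioi 0, s ^ (p - 1) *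
        ((star (u s) ⬝ᵥ A *ᵥ u s).re + s * (star (g s) ⬝ᵥ B *ᵥ g s).re) := by
  have hroot := fun z => mem_slitPlane_of_isRoot_minpoly_conj hA hB (z := z)
  have hQR := hA.matrixPower_neg_half_mul_half
  have hRQ := hA.matrixPower_half_mul_neg_half
  have hRR := hA.matrixPower_half_mul_self
  rw [geomMean]
  set Q := matrixPower A (-(1 / 2))
  set R := matrixPower A (1 / 2)
  set T := Q * B * Q with hT
  let l : Matrix (Fin n) (Fin n) ℂ →ₗ[ℂ] ℂ :=
    { toFun := fun M => star x ⬝ᵥ (R * M * R) *ᵥ x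
      map_add' := fun M N => by
        rw [mul_add, add_mul, Matrix.add_mulVec, dotProduct_add]
      map_smul' := fun c M => by
        rw [mul_smul_comm, smul_mul_assoc, Matrix.smul_mulVec, dotProduct_smul, RingHom.id_apply] }
  obtain ⟨hint, heq⟩ := map_matrixPower_eq_integral hroot hp l
  let g : ℝ → Fin n → ℂ := fun s => (B + (s : ℂ) • A)⁻¹ *ᵥ (A *ᵥ x)
  have hg (s : ℝ) (hs : 0 < s) : B *ᵥ g s + (s : ℂ) • A *ᵥ g s = A *ᵥ x := by
    rw [← Matrix.smul_mulVec, ← Matrix.add_mulVec, Matrix.mulVec_mulVec,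
      Matrix.mul_nonsing_inv _ ((Matrix.isUnit_iff_isUnit_det _).1 (hA.isUnit_add_smul hB hs.le)),
      Matrix.one_mulVec]
  have hl : EqOn (fun s => (l (matrixFunction (powerKernel p 0 s) T)).re)
      (fun s => s ^ (p - 1) * ((star (x - (s : ℂ) • g s) ⬝ᵥ A *ᵥ (x - (s : ℂ) • g s)).re +
        s * (star (g s) ⬝ᵥ B *ᵥ g s).re)) (Ioi 0) := by
    intro s hs
    have h1 := matrixFunction_powerKernel hroot p hs
    set K := matrixFunction (powerKernel p 0 s) T
    have hQA : Q * A = R := by rw [← hRR, ← mul_assoc, hQR, one_mul]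
    have h2 : R * K * Q * (B + (s : ℂ) • A) = ((s ^ (p - 1) : ℝ) : ℂ) • B := by
      have : Q * (B + (s : ℂ) • A) = (T + (s : ℂ) • 1) * R := by
        rw [mul_add, add_mul, mul_smul_comm, hQA, smul_mul_assoc, one_mul, hT, mul_assoc, hQR,
          mul_one]
      rw [mul_assoc, this, mul_assoc, ← mul_assoc K, h1, smul_mul_assoc, mul_smul_comm, hT,
        mul_assoc _ Q R, hQR, mul_one, ← mul_assoc, hRQ, one_mul]
    have h3 : (R * K * R) *ᵥ x = ((s ^ (p - 1) : ℝ) : ℂ) • B *ᵥ g s := by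
      rw [← Matrix.smul_mulVec, ← h2, ← Matrix.mulVec_mulVec _ _ (B + (s : ℂ) • A),
        Matrix.add_mulVec, Matrix.smul_mulVec, hg s hs, Matrix.mulVec_mulVec, mul_assoc _ Q A, hQA]
    have h4 : A *ᵥ (x - (s : ℂ) • g s) = B *ᵥ g s := by
      rw [Matrix.mulVec_sub, Matrix.mulVec_smul, ← hg s hs, add_sub_cancel_right]
    have h5 : l K = star x ⬝ᵥ (R * K * R) *ᵥ x := rfl
    change (l K).re = _
    simp only [h5, h3, h4, dotProduct_smul, smul_eq_mul, star_sub, star_smul, sub_dotProduct,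
      smul_dotProduct, Complex.re_ofReal_mul, Complex.sub_re]
    simp
  refine ⟨fun s => x - (s : ℂ) • g s, g, fun s _ => sub_add_cancel _ _, ?_, ?_⟩
  · exact IntegrableOn.congr_fun hint.re hl measurableSet_Ioi
  · have h6 : star x ⬝ᵥ (R * matrixPower T p * R) *ᵥ x = l (matrixPower T p) := rfl
    rw [h6, heq, Complex.re_ofReal_mul, ← setIntegral_congr_fun measurableSet_Ioi hl]
    congr 1
    exact (integral_re hint).symm

-- This is the integral formula for `x ^ p` at `x = d⁻¹`.
open MeasureTheory Set in
theorem integral_rpow_div_one_add_mul {p : ℝ} (hp : p ∈ Ioo (0 : ℝ) 1) {d : ℝ} (hd : 0 < d) :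
    IntegrableOn (fun s => s ^ (p - 1) / (1 + s * d)) (Ioi 0) ∧
      powerConst p * ∫ s in Ioi 0, s ^ (p - 1) / (1 + s * d) = d ^ (-p) := by
  have h : EqOn (fun s => Real.rpowIntegrand₀₁ p s d⁻¹) (fun s => s ^ (p - 1) / (1 + s * d))
      (Ioi 0) := fun s hs => by
    have hs' : 0 < s := hs
    simp only
    rw [Real.rpowIntegrand₀₁_eq_pow_div hp hs'.le (inv_nonneg.2 hd.le)]
    field_simp
    ring
  refine ⟨(Real.integrableOn_rpowIntegrand₀₁_Ioi hp (inv_nonneg.2 hd.le)).congr_fun h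
    measurableSet_Ioi, ?_⟩
  rw [← setIntegral_congr_fun measurableSet_Ioi h, powerConst,
    ← Real.rpow_eq_const_mul_integral hp (inv_nonneg.2 hd.le), Real.inv_rpow hd.le,
    Real.rpow_neg hd.le]

-- Integrates a lower bound valid for every splitting of `x`, so the actual `u` and `g` need not be
-- known.
open MeasureTheory Set in
theorem sum_mul_rpow_le_re_geomMean {n : ℕ} {A B : Matrix (Fin n) (Fin n) ℂ}
    (hA : IsStrictlyAccretive A) (hB : IsStrictlyAccretive B) {p : ℝ} (hp : p ∈ Ioo (0 : ℝ) 1)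
    {x : Fin n → ℂ} {a d : Fin n → ℝ} (hd : ∀ i, 0 < d i)
    (h : ∀ s : ℝ, 0 < s → ∀ u g : Fin n → ℂ, u + (s : ℂ) • g = x → ∑ i, a i / (1 + s * d i) ≤
      (star u ⬝ᵥ A *ᵥ u).re + s * (star g ⬝ᵥ B *ᵥ g).re) :
    ∑ i, a i * d i ^ (-p) ≤ (star x ⬝ᵥ geomMean p A B *ᵥ x).re := by
  obtain ⟨u, g, hug, hint, heq⟩ := re_geomMean_eq_integral hA hB hp x
  have h1 i : IntegrableOn (fun s => a i * (s ^ (p - 1) / (1 + s * d i))) (Ioi 0) :=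
    (integral_rpow_div_one_add_mul hp (hd i)).1.const_mul _
  have h2 : ∑ i, a i * d i ^ (-p) =
      powerConst p * ∫ s in Ioi 0, ∑ i, a i * (s ^ (p - 1) / (1 + s * d i)) := by
    rw [integral_finsetSum _ fun i _ => h1 i, Finset.mul_sum]
    refine Finset.sum_congr rfl fun i _ => ?_
    rw [integral_const_mul, ← (integral_rpow_div_one_add_mul hp (hd i)).2]
    ring
  rw [h2, heq]
  refine mul_le_mul_of_nonneg_left ?_ (powerConst_pos hp).le
  refine setIntegral_mono_on (integrable_finsetSum _ fun i _ => h1 i) hint measurableSet_Ioi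
    fun s hs => ?_
  calc ∑ i, a i * (s ^ (p - 1) / (1 + s * d i)) = s ^ (p - 1) * ∑ i, a i / (1 + s * d i) := by
        rw [Finset.mul_sum]
        exact Finset.sum_congr rfl fun i _ => by ring
    _ ≤ _ := mul_le_mul_of_nonneg_left (h s hs _ _ (hug s hs)) (Real.rpow_nonneg (le_of_lt hs) _)

/-! ### Simultaneous diagonalization and the bilinear inequality. -/

theorem Matrix.PosDef.exists_simultaneous_diagonalization {n : ℕ} {H K : Matrix (Fin n) (Fin n) ℂ}
    (hH : H.PosDef) (hK : K.PosDef) :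
    ∃ (W : Matrix (Fin n) (Fin n) ℂ) (d : Fin n → ℝ), (∀ i, 0 < d i) ∧ IsUnit W ∧
      Wᴴ * K * W = 1 ∧ Wᴴ * H * W = Matrix.diagonal fun i => (d i : ℂ) := by
  have hS0 : CFC.sqrt K * CFC.sqrt K = K := CFC.sqrt_mul_sqrt_self K hK.posSemidef.nonneg
  have hSH : (CFC.sqrt K)ᴴ = CFC.sqrt K := (CFC.sqrt_nonneg K).isSelfAdjoint
  set S := CFC.sqrt K
  have hS : IsUnit S := by
    rw [Matrix.isUnit_iff_isUnit_det]
    have := (Matrix.isUnit_iff_isUnit_det _).1 hK.isUnit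
    rw [← hS0, Matrix.det_mul] at this
    exact isUnit_of_mul_isUnit_left this
  have hSd := (Matrix.isUnit_iff_isUnit_det _).1 hS
  have hinv : IsUnit S⁻¹ := Matrix.isUnit_nonsing_inv_iff.2 hS
  have hH' : ((S⁻¹)ᴴ * H * S⁻¹).PosDef :=
    hH.conjTranspose_mul_mul_same (Matrix.mulVec_injective_iff_isUnit.2 hinv)
  set U := hH'.1.eigenvectorUnitary
  have hU : (U : Matrix (Fin n) (Fin n) ℂ)ᴴ * U = 1 := Unitary.coe_star_mul_self U
  refine ⟨S⁻¹ * U, hH'.1.eigenvalues, hH'.eigenvalues_pos, hinv.mul (Unitary.isUnit_coe), ?_, ?_⟩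
  · have h1 : (S⁻¹)ᴴ * K * S⁻¹ = 1 := by
      rw [Matrix.conjTranspose_nonsing_inv, hSH, ← hS0, ← mul_assoc,
        Matrix.nonsing_inv_mul _ hSd, one_mul, Matrix.mul_nonsing_inv _ hSd]
    calc (S⁻¹ * (U : Matrix (Fin n) (Fin n) ℂ))ᴴ * K * (S⁻¹ * U)
        = (U : Matrix (Fin n) (Fin n) ℂ)ᴴ * ((S⁻¹)ᴴ * K * S⁻¹) * U := by
          rw [Matrix.conjTranspose_mul]; simp only [mul_assoc]
      _ = 1 := by rw [h1, mul_one, hU]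
  · calc (S⁻¹ * (U : Matrix (Fin n) (Fin n) ℂ))ᴴ * H * (S⁻¹ * U)
        = (U : Matrix (Fin n) (Fin n) ℂ)ᴴ * ((S⁻¹)ᴴ * H * S⁻¹) * U := by
          rw [Matrix.conjTranspose_mul]; simp only [mul_assoc]
      _ = _ := by
          have := hH'.1.conjStarAlgAut_star_eigenvectorUnitary
          rw [Unitary.conjStarAlgAut_star_apply] at this
          exact this

theorem re_dotProduct_mulVec_of_conj_eq_diagonal {n : ℕ} {A W : Matrix (Fin n) (Fin n) ℂ}
    {d : Fin n → ℝ}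
    (h : Wᴴ * (ℜ A : Matrix (Fin n) (Fin n) ℂ) * W = Matrix.diagonal fun i => (d i : ℂ))
    (v : Fin n → ℂ) :
    (star (W *ᵥ v) ⬝ᵥ A *ᵥ (W *ᵥ v)).re = ∑ i, d i * ‖v i‖ ^ 2 := by
  rw [← re_dotProduct_realPart_mulVec, Matrix.star_mulVec, ← Matrix.dotProduct_mulVec,
    Matrix.mulVec_mulVec, Matrix.mulVec_mulVec, h, dotProduct, Complex.re_sum]
  refine Finset.sum_congr rfl fun i _ => ?_
  rw [Matrix.mulVec_diagonal, Pi.star_apply, mul_left_comm, Complex.star_def,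
    ← Complex.normSq_eq_conj_mul_self, ← Complex.ofReal_mul, Complex.ofReal_re,
    Complex.normSq_eq_norm_sq]

/-- After the triangle inequality and clearing the denominator, the gap is `s (d‖u‖ - ‖g‖)²`. -/
theorem norm_add_smul_sq_mul_div_le {d s : ℝ} (hd : 0 < d) (hs : 0 < s) (u g : ℂ) :
    ‖u + s * g‖ ^ 2 * d / (1 + s * d) ≤ d * ‖u‖ ^ 2 + s * ‖g‖ ^ 2 := by
  have h1 : ‖u + s * g‖ ≤ ‖u‖ + s * ‖g‖ := by
    refine (norm_add_le _ _).trans_eq ?_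
    rw [norm_mul, Complex.norm_real, Real.norm_of_nonneg hs.le]
  have h2 : ‖u + s * g‖ ^ 2 ≤ (‖u‖ + s * ‖g‖) ^ 2 := by gcongr
  rw [div_le_iff₀ (by positivity)]
  have h3 := mul_le_mul_of_nonneg_right h2 hd.le
  nlinarith [mul_nonneg hs.le (sq_nonneg (d * ‖u‖ - ‖g‖))]

theorem two_re_dotProduct_mulVec_le_re_geomMean {n : ℕ} {A B Z : Matrix (Fin n) (Fin n) ℂ}
    (hA : IsStrictlyAccretive A)
    (hB : IsStrictlyAccretive B)
    (h₁ : ∀ u v, 2 * (star u ⬝ᵥ Z *ᵥ v).re ≤ (star u ⬝ᵥ A *ᵥ u).re + (star v ⬝ᵥ B *ᵥ v).re)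
    (h₂ : ∀ u v, 2 * (star u ⬝ᵥ Z *ᵥ v).re ≤ (star u ⬝ᵥ B *ᵥ u).re + (star v ⬝ᵥ A *ᵥ v).re)
    {t : ℝ} (ht : t ∈ Set.Icc (0 : ℝ) 1) (x y : Fin n → ℂ) :
    2 * (star x ⬝ᵥ Z *ᵥ y).re ≤
      (star x ⬝ᵥ geomMean t A B *ᵥ x).re + (star y ⬝ᵥ geomMean (1 - t) A B *ᵥ y).re := by
  -- The integral formula needs `0 < t < 1`; the endpoints are the hypotheses themselves.
  rcases eq_or_lt_of_le ht.1 with rfl | ht0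
  · rw [sub_zero, geomMean_zero hA, geomMean_one hA]
    exact h₁ x y
  rcases eq_or_lt_of_le ht.2 with rfl | ht1
  · rw [sub_self, geomMean_zero hA, geomMean_one hA]
    exact h₂ x y
  obtain ⟨W, d, hd, hW, hWB, hWA⟩ := Matrix.PosDef.exists_simultaneous_diagonalization hA hB
  have qA := re_dotProduct_mulVec_of_conj_eq_diagonal hWA
  have qB := re_dotProduct_mulVec_of_conj_eq_diagonal (A := B) (W := W) (d := fun _ => 1)
    (by rw [hWB]; simp)
  simp only [one_mul] at qB
  have hsurj : Function.Surjective (W *ᵥ ·) := Matrix.mulVec_surjective_iff_isUnit.2 hW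
  obtain ⟨y, rfl⟩ := hsurj y
  simp only
  set z := Wᴴ *ᵥ (Zᴴ *ᵥ x) with hz
  have hzv (v : Fin n → ℂ) : (star x ⬝ᵥ Z *ᵥ (W *ᵥ v)).re = ∑ i, (star (z i) * v i).re := by
    rw [← Complex.re_sum]
    congr 1
    change _ = star z ⬝ᵥ v
    rw [hz, Matrix.star_mulVec, Matrix.star_mulVec, Matrix.conjTranspose_conjTranspose,
      Matrix.conjTranspose_conjTranspose, ← Matrix.dotProduct_mulVec, ← Matrix.dotProduct_mulVec]
  have hx : ∑ i, ‖z i‖ ^ 2 * d i ^ (-t) ≤ (star x ⬝ᵥ geomMean t A B *ᵥ x).re := by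
    refine sum_mul_rpow_le_re_geomMean hA hB ⟨ht0, ht1⟩ hd fun s hs u g hug => ?_
    have hpos i : 0 < 1 + s * d i := by have := hd i; positivity
    -- This `v` maximizes `2 Re⟨z, v⟩ - ∑ (1 + s dᵢ)|vᵢ|²`, which is what `h₁` at `u` plus `s` times
    -- `h₂` at `g` bounds.
    let v : Fin n → ℂ := fun i => ((1 + s * d i)⁻¹ : ℝ) * z i
    have e1 := h₁ u (W *ᵥ v)
    have e2 := mul_le_mul_of_nonneg_left (h₂ g (W *ᵥ v)) hs.le
    have e3 : (star x ⬝ᵥ Z *ᵥ (W *ᵥ v)).re =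
        (star u ⬝ᵥ Z *ᵥ (W *ᵥ v)).re + s * (star g ⬝ᵥ Z *ᵥ (W *ᵥ v)).re := by
      rw [← hug, star_add, star_smul, add_dotProduct, smul_dotProduct]
      simp
    rw [hzv] at e3
    rw [qB] at e1
    rw [qA] at e2
    have e4 : ∑ i, ‖z i‖ ^ 2 / (1 + s * d i) = 2 * ∑ i, (star (z i) * v i).re -
        ∑ i, ‖v i‖ ^ 2 - s * ∑ i, d i * ‖v i‖ ^ 2 := by
      rw [Finset.mul_sum, Finset.mul_sum, ← Finset.sum_sub_distrib, ← Finset.sum_sub_distrib]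
      refine Finset.sum_congr rfl fun i _ => ?_
      have f1 : (star (z i) * v i).re = (1 + s * d i)⁻¹ * ‖z i‖ ^ 2 := by
        simp only [v]
        rw [mul_left_comm, Complex.star_def, ← Complex.normSq_eq_conj_mul_self,
          ← Complex.ofReal_mul, Complex.ofReal_re, Complex.normSq_eq_norm_sq]
      have f2 : ‖v i‖ = (1 + s * d i)⁻¹ * ‖z i‖ := by
        simp only [v]
        rw [norm_mul, Complex.norm_real, Real.norm_of_nonneg (inv_nonneg.2 (hpos i).le)]
      rw [f1, f2]
      have := (hpos i).ne'
      field_simp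
      ring
    linarith
  have hy : ∑ i, ‖y i‖ ^ 2 * d i * d i ^ (-(1 - t)) ≤
      (star (W *ᵥ y) ⬝ᵥ geomMean (1 - t) A B *ᵥ (W *ᵥ y)).re := by
    refine sum_mul_rpow_le_re_geomMean hA hB ⟨by linarith, by linarith⟩ hd fun s hs u g hug => ?_
    obtain ⟨u, rfl⟩ := hsurj u
    obtain ⟨g, rfl⟩ := hsurj g
    simp only at hug ⊢
    rw [← Matrix.mulVec_smul, ← Matrix.mulVec_add] at hug
    have hug' := Matrix.mulVec_injective_iff_isUnit.2 hW hug
    rw [qA, qB, Finset.mul_sum, ← Finset.sum_add_distrib, ← hug']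
    exact Finset.sum_le_sum fun i _ => norm_add_smul_sq_mul_div_le (hd i) hs (u i) (g i)
  refine le_trans ?_ (add_le_add hx hy)
  rw [hzv, Finset.mul_sum, ← Finset.sum_add_distrib]
  refine Finset.sum_le_sum fun i _ => ?_
  have f1 : (star (z i) * y i).re ≤ ‖z i‖ * ‖y i‖ := by
    refine (Complex.re_le_norm _).trans_eq ?_
    rw [norm_mul, norm_star]
  have f2 : d i * d i ^ (-(1 - t)) = d i ^ t := by
    rw [← Real.rpow_one_add' (hd i).le (by linarith)]
    congr 1
    ring
  have f3 : d i ^ (-t) * d i ^ t = 1 := by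
    rw [← Real.rpow_add (hd i), neg_add_cancel, Real.rpow_zero]
  rw [mul_assoc _ (d i), f2]
  have p1 : 0 < d i ^ (-t) := Real.rpow_pos_of_pos (hd i) _
  have p2 : 0 < d i ^ t := Real.rpow_pos_of_pos (hd i) _
  have f4 : d i ^ t = (d i ^ (-t))⁻¹ := eq_inv_of_mul_eq_one_right f3
  have f5 : ‖z i‖ ^ 2 * d i ^ (-t) + ‖y i‖ ^ 2 * d i ^ t - 2 * (‖z i‖ * ‖y i‖) =
      d i ^ (-t) * (‖z i‖ - d i ^ t * ‖y i‖) ^ 2 := by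
    linear_combination (2 * ‖z i‖ * ‖y i‖ - d i ^ t * ‖y i‖ ^ 2) * f3
  have f6 := mul_nonneg p1.le (sq_nonneg (‖z i‖ - d i ^ t * ‖y i‖))
  linarith

/-! ### APT block matrices and the polar decomposition. -/

theorem re_dotProduct_conjTranspose_mulVec {n : ℕ} (M : Matrix (Fin n) (Fin n) ℂ)
    (u v : Fin n → ℂ) : (star u ⬝ᵥ Mᴴ *ᵥ v).re = (star v ⬝ᵥ M *ᵥ u).re := by
  rw [Matrix.dotProduct_mulVec, ← Matrix.star_mulVec, Matrix.star_dotProduct]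
  simp

theorem IsAccretive.two_re_le_of_fromBlocks {n : ℕ} {A B X Y : Matrix (Fin n) (Fin n) ℂ}
    (h : IsAccretive (Matrix.fromBlocks A X Yᴴ B)) (u v : Fin n → ℂ) :
    2 * (star u ⬝ᵥ ((2⁻¹ : ℂ) • (X + Y)) *ᵥ v).re ≤
      (star u ⬝ᵥ A *ᵥ u).re + (star v ⬝ᵥ B *ᵥ v).re := by
  have h1 := h.re_nonneg (Sum.elim u (-v))
  have h2 : star (Sum.elim u (-v)) = Sum.elim (star u) (-star v) := by
    ext i
    cases i <;> simp
  rw [h2, Matrix.fromBlocks_mulVec] at h1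
  simp only [Sum.elim_comp_inl, Sum.elim_comp_inr, Matrix.mulVec_neg, sumElim_dotProduct_sumElim,
    dotProduct_add, neg_dotProduct, dotProduct_neg, neg_neg, Complex.add_re, Complex.neg_re,
    re_dotProduct_conjTranspose_mulVec] at h1
  rw [Matrix.smul_mulVec, Matrix.add_mulVec, dotProduct_smul, dotProduct_add]
  have h3 (w : ℂ) : ((2⁻¹ : ℂ) • w).re = 2⁻¹ * w.re := by
    simp
  rw [h3, Complex.add_re]
  linarith

theorem IsAPT.two_re_le {n : ℕ} {A B X Y : Matrix (Fin n) (Fin n) ℂ}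
    (h : IsAPT (Matrix.fromBlocks A X Yᴴ B)) (u v : Fin n → ℂ) :
    2 * (star u ⬝ᵥ ((2⁻¹ : ℂ) • (X + Y))ᴴ *ᵥ v).re ≤
      (star u ⬝ᵥ A *ᵥ u).re + (star v ⬝ᵥ B *ᵥ v).re := by
  have h1 : IsAccretive (Matrix.fromBlocks A Yᴴ (Xᴴ)ᴴ B) := by
    rw [Matrix.conjTranspose_conjTranspose]
    exact h.2
  have h2 : ((2⁻¹ : ℂ) • (X + Y))ᴴ = (2⁻¹ : ℂ) • (Yᴴ + Xᴴ) := by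
    rw [Matrix.conjTranspose_smul, Matrix.conjTranspose_add, add_comm]
    simp
  rw [h2]
  exact h1.two_re_le_of_fromBlocks u v

theorem Matrix.le_half_smul_realPart {n : ℕ} {P G : Matrix (Fin n) (Fin n) ℂ} (hP : P.PosSemidef)
    (h : ∀ x, 2 * (star x ⬝ᵥ P *ᵥ x).re ≤ (star x ⬝ᵥ G *ᵥ x).re) :
    P ≤ (2⁻¹ : ℂ) • (ℜ G : Matrix (Fin n) (Fin n) ℂ) := by
  have hherm : ((2⁻¹ : ℂ) • (ℜ G : Matrix (Fin n) (Fin n) ℂ) - P).IsHermitian := by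
    refine Matrix.IsHermitian.sub ?_ hP.1
    have : (ℜ G : Matrix (Fin n) (Fin n) ℂ)ᴴ = ℜ G := (ℜ G).2
    rw [Matrix.IsHermitian, Matrix.conjTranspose_smul, this]
    simp
  rw [Matrix.le_iff]
  refine Matrix.PosSemidef.of_dotProduct_mulVec_nonneg hherm fun x => ?_
  have h0 : (star x ⬝ᵥ ((2⁻¹ : ℂ) • (ℜ G : Matrix (Fin n) (Fin n) ℂ) - P) *ᵥ x).re =
      2⁻¹ * (star x ⬝ᵥ G *ᵥ x).re - (star x ⬝ᵥ P *ᵥ x).re := by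
    rw [Matrix.sub_mulVec, dotProduct_sub, Matrix.smul_mulVec, dotProduct_smul, Complex.sub_re,
      ← re_dotProduct_realPart_mulVec G]
    simp
  rw [Complex.nonneg_iff, h0]
  refine ⟨by linarith [h x], ?_⟩
  exact (hherm.im_star_dotProduct_mulVec_self x).symm

/-- The right side is nonnegative with square `Z Z*`; positive square roots are unique. -/
theorem CFC.abs_conjTranspose_of_polar {n : ℕ} {Z V : Matrix (Fin n) (Fin n) ℂ}
    (hV : V ∈ Matrix.unitaryGroup (Fin n) ℂ) (hZ : Z = V * CFC.abs Z) :
    CFC.abs Zᴴ = V * CFC.abs Z * Vᴴ := by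
  have hP : (CFC.abs Z)ᴴ = CFC.abs Z := (CFC.abs_nonneg Z).isSelfAdjoint
  have hVV : Vᴴ * V = 1 := Matrix.mem_unitaryGroup_iff'.1 hV
  have hnn : 0 ≤ V * CFC.abs Z * Vᴴ :=
    ((Matrix.nonneg_iff_posSemidef.1 (CFC.abs_nonneg Z)).mul_mul_conjTranspose_same V).nonneg
  rw [CFC.abs]
  refine CFC.sqrt_unique ?_ hnn
  rw [Matrix.star_eq_conjTranspose, Matrix.conjTranspose_conjTranspose]
  have hZ' : Zᴴ = CFC.abs Z * Vᴴ := by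
    rw [← hP, ← Matrix.conjTranspose_mul, ← hZ]
  rw [hZ']
  nth_rewrite 3 [hZ]
  calc V * CFC.abs Z * Vᴴ * (V * CFC.abs Z * Vᴴ)
      = V * CFC.abs Z * (Vᴴ * V) * (CFC.abs Z * Vᴴ) := by simp only [mul_assoc]
    _ = _ := by rw [hVV, mul_one]

theorem mainTheorem8 (n : ℕ) (A B X Y : Matrix (Fin n) (Fin n) ℂ)
    (hA : IsStrictlyAccretive A) (hB : IsStrictlyAccretive B)
    (hM : IsAPT (Matrix.fromBlocks A X Yᴴ B))
    (V : Matrix (Fin n) (Fin n) ℂ) (hV : V ∈ Matrix.unitaryGroup (Fin n) ℂ)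
    (hpolar : (2⁻¹ : ℂ) • (X + Y) = V * CFC.abs ((2⁻¹ : ℂ) • (X + Y)))
    (t : ℝ) (ht : t ∈ Set.Icc (0 : ℝ) 1) :
    CFC.abs ((2⁻¹ : ℂ) • (X + Y)) ≤
        (2⁻¹ : ℂ) • (ℜ (geomMean t A B + Vᴴ * geomMean (1 - t) A B * V) :
          Matrix (Fin n) (Fin n) ℂ) ∧
      CFC.abs ((2⁻¹ : ℂ) • (Xᴴ + Yᴴ)) ≤
        (2⁻¹ : ℂ) • (ℜ (V * geomMean t A B * Vᴴ + geomMean (1 - t) A B) :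
          Matrix (Fin n) (Fin n) ℂ) := by
  have h₁ := hM.two_re_le
  have h₂ (u v : Fin n → ℂ) := hM.1.two_re_le_of_fromBlocks v u
  have hZ : (2⁻¹ : ℂ) • (Xᴴ + Yᴴ) = ((2⁻¹ : ℂ) • (X + Y))ᴴ := by
    rw [Matrix.conjTranspose_smul, Matrix.conjTranspose_add]
    simp
  rw [hZ, CFC.abs_conjTranspose_of_polar hV hpolar]
  set Z := (2⁻¹ : ℂ) • (X + Y)
  -- The inequality is applied to `Z*`: the partial transpose supplies one hypothesis, `M` the
  -- other.
  have key := two_re_dotProduct_mulVec_le_re_geomMean hA hB h₁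
    (fun u v => by
      rw [re_dotProduct_conjTranspose_mulVec, add_comm]
      exact h₂ u v) ht
  simp only [re_dotProduct_conjTranspose_mulVec] at key
  have hP : (CFC.abs Z).PosSemidef := Matrix.nonneg_iff_posSemidef.1 (CFC.abs_nonneg Z)
  have hVV : Vᴴ * V = 1 := Matrix.mem_unitaryGroup_iff'.1 hV
  have hconj (N M : Matrix (Fin n) (Fin n) ℂ) (x : Fin n → ℂ) :
      star x ⬝ᵥ (Nᴴ * M * N) *ᵥ x = star (N *ᵥ x) ⬝ᵥ M *ᵥ (N *ᵥ x) := by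
    rw [Matrix.star_mulVec, ← Matrix.dotProduct_mulVec, Matrix.mulVec_mulVec,
      Matrix.mulVec_mulVec, mul_assoc]
  constructor
  · refine Matrix.le_half_smul_realPart hP fun x => ?_
    -- `V* Z = |Z|` makes the pairing `⟨x, |Z| x⟩`.
    have h := key x (V *ᵥ x)
    rw [Matrix.add_mulVec, dotProduct_add, Complex.add_re, hconj]
    refine le_of_eq_of_le ?_ h
    rw [Matrix.star_mulVec, ← Matrix.dotProduct_mulVec, Matrix.mulVec_mulVec]
    congr 5
    nth_rewrite 2 [hpolar]
    rw [← mul_assoc, hVV, one_mul]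
  · refine Matrix.le_half_smul_realPart (hP.mul_mul_conjTranspose_same V) fun x => ?_
    -- Here the pairing is `⟨x, Z V* x⟩`, and `Z V* = V |Z| V*`.
    have h := key (Vᴴ *ᵥ x) x
    have hc := hconj Vᴴ (geomMean t A B) x
    rw [Matrix.conjTranspose_conjTranspose] at hc
    rw [Matrix.add_mulVec, dotProduct_add, Complex.add_re, hc]
    refine le_of_eq_of_le ?_ h
    rw [Matrix.mulVec_mulVec, ← hpolar]
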